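/- For real $x$ let $\|x\|$ be the distance from $x$ to the nearest integer. For an irrational number $\alpha$ and a real number $\gamma$ put $$M(\alpha,\gamma)=\liminf_{|n|\to\infty}|n|\,\|n\alpha-\gamma\|\quad(n\in\mathbb Z),\qquad \rho(\alpha)=\sup_{\gamma\notin\mathbb Z+\alpha\mathbb Z}M(\alpha,\gamma).$$ Let $\alpha_0=\{\alpha\}$ be the fractional part of $\alpha$ (so $\alpha_0=\alpha$ if $\alpha\in(0,1)$), and let the partial quotients $a_1,a_2,\ldots$ of its negative ("round-up") continued fraction expansion $\alpha_0=\cfrac{1}{a_1-\cfrac{1}{a_2-\cdots}}$ be generated by $a_{n+1}=\lceil 1/\alpha_n\rceil$, $\alpha_{n+1}=\lceil 1/\alpha_n\rceil-1/\alpha_n$. Define $p_{-1}=-1$, $p_0=0$, $q_{-1}=0$, $q_0=1$, $p_{n+1}=a_{n+1}p_n-p_{n-1}$, $q_{n+1}=a_{n+1}q_n-q_{n-1}$ and $D_n=q_n\alpha_0-p_n$. Let $t_i=0$ if $a_i$ is even and $t_i=(-1)^{j+1}$ if $a_i$ is the $j$-th odd partial quotient, and let $$\gamma^*=\sum_{i=1}^{\infty}\tfrac12\,(a_i-2+t_i)\,D_{i-1}.$$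 For an integer $r\ge 3$ let $(R_*,R_{**})=(r,r+1)$ if $r$ is even and $(R_*,R_{**})=(r+1,r)$ if $r$ is odd, and put $$\beta=\tfrac12\Bigl(R_*-\sqrt{R_*^2-4}\Bigr),\qquad \delta=\frac{1}{R_{**}-\beta},\qquad C(r)=\frac{(1-2\delta)(1-\beta)}{4(1-\delta\beta)};$$ put also $C(\infty)=\lim_{r\to\infty}C(r)=\tfrac14$. **Theorem.** Let $\alpha$ be irrational and suppose that $R=\liminf_{i\to\infty}a_i\ge 3$ (where $R=\infty$ is allowed). Then the series for $\gamma^*$ converges, $\gamma^*\in(0,1)$, $\gamma^*\notin\mathbb Z+\alpha\mathbb Z$, and $$\rho(\alpha)\ \ge\ M(\alpha,\gamma^*)\ \ge\ C(R).$$ In particular, when $R=3$, $$\rho(\alpha)\ \ge\ C(3)=\frac{1}{6\sqrt3+8},$$ and when $R\ge 4$, $$\rho(\alpha)\ \ge\ C(4)=\frac{1}{4\sqrt3+2}.$$ -/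

import Mathlib

noncomputable section

namespace NegCF

/-- The distance from `x` to the nearest integer. -/
def nearestDist (x : ℝ) : ℝ := |x - round x|

/-- The two-sided inhomogeneous approximation constant
`M(α, γ) = liminf_{|n| → ∞} |n| ‖n α - γ‖`, with `n` ranging over the integers
(on `ℤ` the cofinite filter is the filter `|n| → ∞`). It takes extended real values, so that
the lower limit is always the true one. -/
def M (α γ : ℝ) : EReal :=
  Filter.liminf (fun n : ℤ => ((|(n : ℝ)| * nearestDist (n * α - γ) : ℝ) : EReal))
    Filter.cofinite

/-- The subset `ℤ + α ℤ` of the real line. -/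
def homogeneous (α : ℝ) : Set ℝ := {γ | ∃ m l : ℤ, γ = m + l * α}

/-- `ρ(α)`, the supremum of `M(α, γ)` over the real numbers `γ ∉ ℤ + α ℤ`. -/
def rho (α : ℝ) : EReal := ⨆ γ ∈ (homogeneous α)ᶜ, M α γ

/-- The complete quotients of the negative expansion: `α₀ = {α}`,
`α_{n+1} = ⌈1 / α_n⌉ - 1 / α_n`. -/
def rem (α : ℝ) : ℕ → ℝ
  | 0 => Int.fract α
  | n + 1 => (⌈1 / rem α n⌉ : ℝ) - 1 / rem α n

/-- The partial quotients of the negative expansion, numbered from `0`: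
`pq α n` is `a_{n+1} = ⌈1 / α_n⌉`. -/
def pq (α : ℝ) (n : ℕ) : ℕ := ⌈1 / rem α n⌉₊

/-- Numerators of the convergents: `p_{-1} = -1`, `p_0 = 0` (hence `p_1 = 1`),
`p_{n+1} = a_{n+1} p_n - p_{n-1}`. -/
def convNum (α : ℝ) : ℕ → ℤ
  | 0 => 0
  | 1 => 1
  | n + 2 => pq α (n + 1) * convNum α (n + 1) - convNum α n

/-- Denominators of the convergents: `q_{-1} = 0`, `q_0 = 1` (hence `q_1 = a_1`),
`q_{n+1} = a_{n+1} q_n - q_{n-1}`. -/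
def convDen (α : ℝ) : ℕ → ℤ
  | 0 => 1
  | 1 => pq α 0
  | n + 2 => pq α (n + 1) * convDen α (n + 1) - convDen α n

/-- `D_n = q_n α₀ - p_n`, where `α₀ = {α}`. -/
def D (α : ℝ) (n : ℕ) : ℝ := convDen α n * Int.fract α - convNum α n

/-- `R = liminf a_i`, a natural number or `∞`. -/
def R (α : ℝ) : ℕ∞ := Filter.liminf (fun n : ℕ => (pq α n : ℕ∞)) Filter.atTop

/-- `tSeq α n` is `t_{n+1}`: it is `0` if `a_{n+1}` is even, and `(-1)^(j+1)` if `a_{n+1}` is the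
`j`-th odd partial quotient. -/
def tSeq (α : ℝ) (n : ℕ) : ℤ :=
  if Even (pq α n) then 0
  else (-1) ^ (((Finset.range (n + 1)).filter (fun k => Odd (pq α k))).card + 1)

/-- The `n`-th term `½ (a_{n+1} - 2 + t_{n+1}) D_n` of the series for `γ*`. -/
def gammaTerm (α : ℝ) (n : ℕ) : ℝ := (1 / 2) * ((pq α n : ℝ) - 2 + tSeq α n) * D α n

/-- `γ*`, the sum of the terms `½ (a_i - 2 + t_i) D_{i-1}` over `i ≥ 1`. -/
def gammaStar (α : ℝ) : ℝ := ∑' n, gammaTerm α n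

/-- `R_*`, which is `r` if `r` is even and `r + 1` if `r` is odd. -/
def rOne (r : ℕ) : ℝ := if Even r then r else r + 1

/-- `R_**`, which is `r + 1` if `r` is even and `r` if `r` is odd. -/
def rTwo (r : ℕ) : ℝ := if Even r then r + 1 else r

/-- `β = ½ (R_* - √(R_*² - 4))`. -/
def beta (r : ℕ) : ℝ := (1 / 2) * (rOne r - √(rOne r ^ 2 - 4))

/-- `δ = 1 / (R_** - β)`. -/
def delta (r : ℕ) : ℝ := 1 / (rTwo r - beta r)

/-- `C(r) = (1 - 2 δ) (1 - β) / (4 (1 - δ β))` for finite `r`. -/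
def C (r : ℕ) : ℝ := (1 - 2 * delta r) * (1 - beta r) / (4 * (1 - delta r * beta r))

/-- `C` extended to `∞` by the limit value `C(∞) = 1/4`. -/
def CExt (r : ℕ∞) : ℝ := if r = ⊤ then 1 / 4 else C r.toNat

end NegCF

end

namespace NegCF

/-! The relation D_{n+1} = a_{n+1} D_n - D_{n-1} turns the a_i - 2 part of the series into a
telescoping second difference, so 2γ* = 1 - α₀ + ∑ t_i D_{i-1}. Hence (2n+1, 2(nα₀ - m - γ*)) runs
over a grid, and the claim is that the product of these coordinates is asymptotically at least 4C(R)
in absolute value.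

For each k the grid has integer coordinates (A, B) relative to the k-th convergents (`height`,
`width`). Passing to the next frame sends (A, B) to (B, aB - A ± t). As t is odd exactly when a is,
A and B stay odd (`odd_next`); in particular they never vanish. The alternating signs of the t_i
keep the offsets `headSum` and `tailSum` between 0 and q_{n-1}, respectively D_n.

After reflection, A ≥ 1. If B < 0, the product is at least 1 (`one_le_of_opposite`). If A = B,
`product_bound` gives 4C(r) up to an arbitrarily small error (`diagonal_bound`). If 0 < B < A,
`descent` changes frame until B turns negative or the point lies between two diagonal points, where
concavity applies. If B ≥ A, the width is at least a positive constant of the frame (`width_lower`),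
so the product is harmless once |n| is large.

The constant C(r) corresponds to one odd quotient R_** surrounded by quotients R_*: on one side the
ratio and its offset both equal δ, on the other they are β and 0. -/

/-! ### The constants β, δ and C(r) -/

lemma four_le_rOne {r : ℕ} (hr : 3 ≤ r) : 4 ≤ rOne r := by
  unfold rOne
  split_ifs with h
  · have : 4 ≤ r := by
      obtain ⟨k, hk⟩ := h
      omega
    exact_mod_cast this
  · have : (3 : ℝ) ≤ r := by exact_mod_cast hr
    linarith

lemma three_le_rTwo {r : ℕ} (hr : 3 ≤ r) : 3 ≤ rTwo r := by
  have : (3 : ℝ) ≤ r := by exact_mod_cast hr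
  unfold rTwo
  split_ifs <;> linarith

lemma le_rOne (r : ℕ) : (r : ℝ) ≤ rOne r := by
  unfold rOne; split_ifs <;> linarith

lemma le_rTwo (r : ℕ) : (r : ℝ) ≤ rTwo r := by
  unfold rTwo; split_ifs <;> linarith

lemma rOne_le_rTwo_add_one (r : ℕ) : rOne r ≤ rTwo r + 1 := by
  unfold rOne rTwo; split_ifs <;> linarith

/-- R_* and R_** are the least even and the least odd integer not below r; this is the only way
parity enters the extremal constants. -/
lemma rOne_le_of_even {r a : ℕ} (h : r ≤ a) (ha : Even a) : rOne r ≤ a := by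
  unfold rOne
  split_ifs with hr
  · exact_mod_cast h
  · have : r + 1 ≤ a := by
      rcases h.eq_or_lt with rfl | h
      · exact absurd ha hr
      · exact h
    exact_mod_cast this

lemma rTwo_le_of_not_even {r a : ℕ} (h : r ≤ a) (ha : ¬ Even a) : rTwo r ≤ a := by
  unfold rTwo
  split_ifs with hr
  · have : r + 1 ≤ a := by
      rcases h.eq_or_lt with rfl | h
      · exact absurd hr ha
      · exact h
    exact_mod_cast this
  · exact_mod_cast h

lemma beta_mul {r : ℕ} (hr : 3 ≤ r) : beta r * (rOne r - beta r) = 1 := by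
  have h4 := four_le_rOne hr
  have hs : √(rOne r ^ 2 - 4) ^ 2 = rOne r ^ 2 - 4 := Real.sq_sqrt (by nlinarith)
  unfold beta
  nlinarith

lemma beta_pos {r : ℕ} (hr : 3 ≤ r) : 0 < beta r := by
  have h4 := four_le_rOne hr
  have : √(rOne r ^ 2 - 4) < rOne r := by
    rw [Real.sqrt_lt' (by linarith)]; linarith
  unfold beta
  linarith

lemma beta_lt {r : ℕ} (hr : 3 ≤ r) : beta r < 1 / 3 := by
  have h4 := four_le_rOne hr
  have : rOne r - 2 / 3 < √(rOne r ^ 2 - 4) := by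
    apply Real.lt_sqrt_of_sq_lt; nlinarith
  unfold beta
  linarith

lemma delta_mul {r : ℕ} (hr : 3 ≤ r) : delta r * (rTwo r - beta r) = 1 := by
  have := three_le_rTwo hr
  have := beta_lt hr
  unfold delta
  exact one_div_mul_cancel (by linarith)

lemma delta_pos {r : ℕ} (hr : 3 ≤ r) : 0 < delta r := by
  have := three_le_rTwo hr
  have := beta_lt hr
  unfold delta
  exact one_div_pos.2 (by linarith)

lemma delta_lt {r : ℕ} (hr : 3 ≤ r) : delta r < 3 / 8 := by
  have := three_le_rTwo hr
  have := beta_lt hr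
  unfold delta
  rw [div_lt_div_iff₀ (by linarith) (by norm_num)]
  linarith

lemma delta_mul_beta_lt {r : ℕ} (hr : 3 ≤ r) : delta r * beta r < 1 / 8 := by
  nlinarith [delta_pos hr, delta_lt hr, beta_pos hr, beta_lt hr]

lemma four_mul_C {r : ℕ} (hr : 3 ≤ r) :
    4 * C r * (1 - delta r * beta r) = (1 - 2 * delta r) * (1 - beta r) := by
  have := delta_mul_beta_lt hr
  have h : 1 - delta r * beta r ≠ 0 := by linarith
  unfold C
  field_simp

lemma C_pos {r : ℕ} (hr : 3 ≤ r) : 0 < C r := by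
  have := delta_mul_beta_lt hr
  have := delta_lt hr
  have := beta_lt hr
  unfold C
  apply div_pos (mul_pos _ _) <;> linarith

lemma four_mul_C_le_one {r : ℕ} (hr : 3 ≤ r) : 4 * C r ≤ 1 := by
  have h1 := delta_mul_beta_lt hr
  have h2 := delta_lt hr
  have h3 := beta_lt hr
  have h4 := delta_pos hr
  have h5 := beta_pos hr
  have := four_mul_C hr
  by_contra! h
  nlinarith

/-! ### The extremal inequality -/

/-- One step of the continued fraction halves the excess of `y - s` over `β`. -/
lemma gap_step {r a : ℕ} (hr : 3 ≤ r) (ha : r ≤ a) {y' s' y s e : ℝ} (hs' : 0 ≤ s')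
    (hsy : s' ≤ y') (hy' : y' ≤ 1 / 2) (he : 0 ≤ e) (h : y' - s' ≤ beta r + e)
    (hy : y * (a - y') = 1) (hs : s = if Even a then y * s' else y * (1 - s')) :
    y - s ≤ beta r + e / 2 := by
  have hb := beta_mul hr
  have hb0 := beta_pos hr
  have hb1 := beta_lt hr
  have h4 := four_le_rOne hr
  have ha3 : (3 : ℝ) ≤ a := by exact_mod_cast hr.trans ha
  have hy0 : 0 < y := by
    by_contra! hn
    nlinarith
  by_cases hE : Even a
  · have hR := rOne_le_of_even ha hE
    rw [if_pos hE] at hs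
    have key : 1 - s' ≤ (a - y') * (beta r + e / 2) := by
      have h1 : (rOne r - y') * (beta r + e / 2) ≤ (a - y') * (beta r + e / 2) := by
        gcongr
      have h2 : beta r * y' - s' ≤ beta r ^ 2 + e := by nlinarith
      nlinarith
    calc y - s = y * (1 - s') := by rw [hs]; ring
      _ ≤ y * ((a - y') * (beta r + e / 2)) := by gcongr
      _ = y * (a - y') * (beta r + e / 2) := by ring
      _ = _ := by rw [hy, one_mul]
  · have hR := rTwo_le_of_not_even ha hE
    have hR' := rOne_le_rTwo_add_one r
    rw [if_neg hE] at hs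
    have key : s' ≤ (a - y') * beta r := by
      have h1 : (rOne r - 1 - y') * beta r ≤ (a - y') * beta r := by
        gcongr; linarith
      nlinarith
    calc y - s = y * s' := by rw [hs]; ring
      _ ≤ y * ((a - y') * beta r) := by gcongr
      _ = y * (a - y') * beta r := by ring
      _ = beta r := by rw [hy, one_mul]
      _ ≤ _ := by linarith

/-- The factor of the extremal product on the side of the digit `a`, compared with its extremal
value. -/
lemma one_sub_add_bound {r a : ℕ} (hr : 3 ≤ r) (ha : r ≤ a) {x' u' x u e : ℝ} (hu' : 0 ≤ u')
    (hux : u' ≤ x') (hx' : x' * (r - 1) ≤ 1) (he : 0 ≤ e) (h : x' - u' ≤ beta r + e)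
    (hx : x * (a - x') = 1) (hu : u = if Even a then x * u' else x * (1 - u')) :
    (1 - 2 * delta r) * (1 - x * beta r) ≤ (1 - x - u + e) * (1 - delta r * beta r) := by
  have hb0 := beta_pos hr
  have hb1 := beta_lt hr
  have hd := delta_mul hr
  have hd0 := delta_pos hr
  have hd1 := delta_lt hr
  have hdb := delta_mul_beta_lt hr
  have hr3 : (3 : ℝ) ≤ r := by exact_mod_cast hr
  have hra : (r : ℝ) ≤ a := by exact_mod_cast ha
  have hx2 : x' ≤ 1 / 2 := by nlinarith
  have hx0 : 0 < x := by
    by_contra! hn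
    nlinarith
  have hx1 : x ≤ 1 / 2 := by nlinarith
  generalize beta r = β at *
  generalize delta r = δ at *
  have hδβ : 0 < δ * β := mul_pos hd0 hb0
  by_cases hE : Even a
  · have hR := rOne_le_of_even ha hE
    rw [if_pos hE] at hu
    -- An even digit is not extremal: the offset is x u' instead of x(1 - u'), so rough numerical
    -- bounds suffice.
    have key : (1 + u') * (1 - δ * β) - β * (1 - 2 * δ) ≤ δ * (2 - β) * (a - x') := by
      by_cases hre : Even r
      · have e2 : rTwo r = r + 1 := by unfold rTwo; rw [if_pos hre]
        have hr4 : (4 : ℝ) ≤ r := by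
          have : 4 ≤ r := by
            obtain ⟨k, hk⟩ := hre
            omega
          exact_mod_cast this
        rw [e2] at hd
        have hx3 : x' ≤ 1 / 3 := by nlinarith
        -- Here r ≥ 4 and β < 1/3, so r + 1 - β ≥ 14/3.
        have hd2 : δ ≤ 3 / 14 := by nlinarith
        have h1 : δ * (2 - β) * (r - x') ≤ δ * (2 - β) * (a - x') := by
          have : 0 ≤ δ * (2 - β) := mul_nonneg hd0.le (by linarith)
          gcongr
        have h2 : δ * (2 - β) * (r - x') = (2 - β) * (1 - δ * (1 + x' - β)) := by
          linear_combination (2 - β) * hd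
        have h3 : δ * (1 + x' - β) ≤ 3 / 14 * (4 / 3) := by
          apply mul_le_mul hd2 <;> linarith
        have h4 : (2 - β) * (1 - 3 / 14 * (4 / 3)) ≤ (2 - β) * (1 - δ * (1 + x' - β)) := by
          apply mul_le_mul_of_nonneg_left <;> linarith
        have h5 : (1 + u') * (1 - δ * β) ≤ (1 + 1 / 3) * (1 - δ * β) := by
          apply mul_le_mul_of_nonneg_right <;> linarith
        have h6 : δ * β ≤ 3 / 14 * (1 / 3) := by
          apply mul_le_mul <;> linarith
        rw [h2] at h1
        linarith
      · have e1 : rOne r = r + 1 := by unfold rOne; rw [if_neg hre]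
        have e2 : rTwo r = r := by unfold rTwo; rw [if_neg hre]
        rw [e2] at hd
        rw [e1] at hR
        have h1 : δ * (2 - β) * (r + 1 - x') ≤ δ * (2 - β) * (a - x') := by
          have : 0 ≤ δ * (2 - β) := mul_nonneg hd0.le (by linarith)
          gcongr
        have h2 : δ * (2 - β) * (r + 1 - x') = (2 - β) * (1 + δ * (1 - x' + β)) := by
          linear_combination (2 - β) * hd
        have h3 : 0 ≤ δ * (1 - x' + β) := mul_nonneg hd0.le (by linarith)
        have h4 : (2 - β) * 1 ≤ (2 - β) * (1 + δ * (1 - x' + β)) := by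
          apply mul_le_mul_of_nonneg_left <;> linarith
        have h5 : (1 + u') * (1 - δ * β) ≤ (1 + 1 / 2) * (1 - δ * β) := by
          apply mul_le_mul_of_nonneg_right <;> linarith
        rw [h2] at h1
        linarith
    -- The terms free of x add up to δ(2 - β); multiplying them by x(a - x') = 1 lets x be factored
    -- out.
    have hfin : (1 - x - u) * (1 - δ * β) - (1 - 2 * δ) * (1 - x * β)
        = x * (δ * (2 - β) * (a - x') - ((1 + u') * (1 - δ * β) - β * (1 - 2 * δ))) := by
      rw [hu]
      linear_combination (-(δ * (2 - β))) * hx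
    have : 0 ≤ x * (δ * (2 - β) * (a - x') - ((1 + u') * (1 - δ * β) - β * (1 - 2 * δ))) :=
      mul_nonneg hx0.le (by linarith)
    have : 0 ≤ e * (1 - δ * β) := mul_nonneg he (by linarith)
    linarith
  · have hR := rTwo_le_of_not_even ha hE
    rw [if_neg hE] at hu
    have hw : 0 ≤ δ * (2 - β) := mul_nonneg hd0.le (by linarith)
    have h1 : δ * (2 - β) * (rTwo r - x') ≤ δ * (2 - β) * (a - x') := by
      gcongr
    have h2 : δ * (2 - β) * (rTwo r - x') = (2 - β) * (1 + δ * β - δ * x') := by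
      linear_combination (2 - β) * hd
    have h3 : δ * (2 - β) * (x' - β) ≤ δ * (2 - β) * (u' + e) := by
      gcongr; linarith
    have h4 : δ * (2 - β) * (u' + e) ≤ (1 - δ * β) * (u' + e) := by
      gcongr
      linarith
    have key : (2 - u' - e) * (1 - δ * β) - β * (1 - 2 * δ) ≤ δ * (2 - β) * (a - x') := by
      linarith
    have hfin : (1 - x - u + x * e) * (1 - δ * β) - (1 - 2 * δ) * (1 - x * β)
        = x * (δ * (2 - β) * (a - x') - ((2 - u' - e) * (1 - δ * β) - β * (1 - 2 * δ))) := by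
      rw [hu]
      linear_combination (-(δ * (2 - β))) * hx
    have : 0 ≤ x * (δ * (2 - β) * (a - x') - ((2 - u' - e) * (1 - δ * β) - β * (1 - 2 * δ))) :=
      mul_nonneg hx0.le (by linarith)
    have : 0 ≤ (e - x * e) * (1 - δ * β) := mul_nonneg (by nlinarith) (by linarith)
    linarith

/-- Companion of `one_sub_add_bound`: when the two are multiplied, the auxiliary factor 1 - xβ
cancels and C(r) appears. The difference of the sides is (β + e + s - y)(1 - x) + (s + e) x (1 - β).
-/
lemma one_sub_bound {r : ℕ} (hr : 3 ≤ r) {x y s e : ℝ} (hx0 : 0 ≤ x) (hx1 : x ≤ 1) (hs : 0 ≤ s)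
    (he : 0 ≤ e) (h : y - s ≤ beta r + e) :
    (1 - beta r) * (1 - x * y) ≤ (1 - y + s + e) * (1 - x * beta r) := by
  have hb1 := beta_lt hr
  have h1 : 0 ≤ (beta r + e + s - y) * (1 - x) := mul_nonneg (by linarith) (by linarith)
  have h2 : 0 ≤ (s + e) * (x * (1 - beta r)) :=
    mul_nonneg (by linarith) (mul_nonneg hx0 (by linarith))
  linarith

/-- The extremal product, up to an error controlled by `e`. -/
lemma product_bound {r a : ℕ} (hr : 3 ≤ r) (ha : r ≤ a) {x' u' x u y s e : ℝ} (hu' : 0 ≤ u')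
    (hux : u' ≤ x') (hx' : x' * (r - 1) ≤ 1) (he : 0 ≤ e) (he1 : e ≤ 1)
    (h : x' - u' ≤ beta r + e)
    (hx : x * (a - x') = 1) (hu : u = if Even a then x * u' else x * (1 - u'))
    (hs0 : 0 ≤ s) (hsy : s ≤ y) (hy : y ≤ 1 / 2) (h' : y - s ≤ beta r + e) :
    4 * C r * (1 - x * y) - 3 * e ≤ (1 - y + s) * (1 - x - u) := by
  have hr3 : (3 : ℝ) ≤ r := by exact_mod_cast hr
  have hra : (r : ℝ) ≤ a := by exact_mod_cast ha
  have hx2 : x' ≤ 1 / 2 := by nlinarith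
  have hx0 : 0 < x := by
    by_contra! hn
    nlinarith
  have hx1 : x ≤ 1 / 2 := by nlinarith
  have hu0 : 0 ≤ u := by
    rw [hu]
    split_ifs
    · positivity
    · exact mul_nonneg hx0.le (by linarith)
  have hux1 : u ≤ x := by
    rw [hu]
    split_ifs <;> nlinarith
  have h1 := one_sub_add_bound hr ha hu' hux hx' he h hx hu
  have h2 := one_sub_bound hr hx0.le (by linarith) hs0 he h'
  have hC := four_mul_C hr
  have hb1 := beta_lt hr
  have hb0 := beta_pos hr
  have hd1 := delta_lt hr
  have hdb := delta_mul_beta_lt hr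
  have hxb : 0 < 1 - x * beta r := by nlinarith
  have hm := mul_le_mul h1 h2 (mul_nonneg (by linarith) (by nlinarith))
    (mul_nonneg (by linarith) (by linarith))
  have hm' : (4 * C r * (1 - x * y)) * ((1 - delta r * beta r) * (1 - x * beta r)) ≤
      ((1 - y + s + e) * (1 - x - u + e)) * ((1 - delta r * beta r) * (1 - x * beta r)) := by
    calc _ = (4 * C r * (1 - delta r * beta r)) * ((1 - x * y) * (1 - x * beta r)) := by ring
      _ = (1 - 2 * delta r) * (1 - x * beta r) * ((1 - beta r) * (1 - x * y)) := by
        rw [hC]; ring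
      _ ≤ _ := hm
      _ = _ := by ring
  have hp := le_of_mul_le_mul_right hm' (mul_pos (by linarith) hxb)
  nlinarith

/-! ### Size and special values of C(r) -/

/-- Serves the case R = ∞, where the bounds for all finite r must tend to 1/4. -/
lemma C_lower {r : ℕ} (hr : 3 ≤ r) : (1 - 3 / ((r : ℝ) - 1)) / 4 ≤ C r := by
  have hr3 : (3 : ℝ) ≤ r := by exact_mod_cast hr
  have hb0 := beta_pos hr
  have hb1 := beta_lt hr
  have hd0 := delta_pos hr
  have hd1 := delta_lt hr
  have hdb := delta_mul_beta_lt hr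
  have hb : beta r ≤ 1 / ((r : ℝ) - 1) := by
    rw [le_div_iff₀ (by linarith)]
    nlinarith [beta_mul hr, le_rOne r]
  have hd : delta r ≤ 1 / ((r : ℝ) - 1) := by
    rw [le_div_iff₀ (by linarith)]
    nlinarith [delta_mul hr, le_rTwo r]
  have h3 : 3 / ((r : ℝ) - 1) = 3 * (1 / ((r : ℝ) - 1)) := by ring
  have := four_mul_C hr
  nlinarith [C_pos hr, mul_pos hd0 hb0]

lemma C_three : C 3 = 1 / (6 * √3 + 8) := by
  have h12 : √(12 : ℝ) = 2 * √3 := by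
    rw [show (12 : ℝ) = 2 ^ 2 * 3 by norm_num, Real.sqrt_mul (by norm_num),
      Real.sqrt_sq (by norm_num)]
  have h3 : √(3 : ℝ) ^ 2 = 3 := Real.sq_sqrt (by norm_num)
  have h0 : 0 < √(3 : ℝ) := by positivity
  have e1 : rOne 3 = 4 := by
    unfold rOne; rw [if_neg (by decide)]; norm_num
  have e2 : rTwo 3 = 3 := by
    unfold rTwo; rw [if_neg (by decide)]; norm_num
  have hb : beta 3 = 2 - √3 := by
    unfold beta; rw [e1, show (4 : ℝ) ^ 2 - 4 = 12 by norm_num, h12]; ring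
  have hd : delta 3 = (√3 - 1) / 2 := by
    unfold delta; rw [e2, hb, div_eq_div_iff (by linarith) (by norm_num)]; nlinarith
  have := four_mul_C (le_refl 3)
  rw [hb, hd] at this
  have t : 2 * C 3 * (7 - 3 * √3) = 3 * √3 - 5 := by
    linear_combination this - (2 * C 3 + 1) * h3
  have t' : 44 * C 3 = 6 * √3 - 8 := by
    linear_combination (7 + 3 * √3) * t + (18 * C 3 + 9) * h3
  rw [eq_div_iff (by positivity)]
  linear_combination (6 * √3 + 8) / 44 * t' + 36 / 44 * h3

lemma C_four : C 4 = 1 / (4 * √3 + 2) := by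
  have h12 : √(12 : ℝ) = 2 * √3 := by
    rw [show (12 : ℝ) = 2 ^ 2 * 3 by norm_num, Real.sqrt_mul (by norm_num),
      Real.sqrt_sq (by norm_num)]
  have h3 : √(3 : ℝ) ^ 2 = 3 := Real.sq_sqrt (by norm_num)
  have h0 : 0 < √(3 : ℝ) := by positivity
  have e1 : rOne 4 = 4 := by
    unfold rOne; rw [if_pos (by decide)]; norm_num
  have e2 : rTwo 4 = 5 := by
    unfold rTwo; rw [if_pos (by decide)]; norm_num
  have hb : beta 4 = 2 - √3 := by
    unfold beta; rw [e1, show (4 : ℝ) ^ 2 - 4 = 12 by norm_num, h12]; ring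
  have hd : delta 4 = (3 - √3) / 6 := by
    unfold delta; rw [e2, hb, div_eq_div_iff (by linarith) (by norm_num)]; nlinarith
  have := four_mul_C (show 3 ≤ 4 by norm_num)
  rw [hb, hd] at this
  have t : 2 * C 4 * (5 * √3 - 3) = 3 - √3 := by
    linear_combination 3 * this + (2 * C 4 + 1) * h3
  have t' : 22 * C 4 = 2 * √3 - 1 := by
    linear_combination (5 * √3 + 3) / 6 * t - (25 / 3 * C 4 + 5 / 6) * h3
  rw [eq_div_iff (by positivity)]
  linear_combination (4 * √3 + 2) / 22 * t' + 8 / 22 * h3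

/-! ### The expansion -/

lemma rem_spec {α : ℝ} (hα : Irrational α) (n : ℕ) :
    Irrational (rem α n) ∧ 0 < rem α n ∧ rem α n < 1 := by
  induction n with
  | zero =>
    have h : Irrational (rem α 0) := by
      have := hα.sub_intCast ⌊α⌋
      simpa only [rem, Int.fract] using this
    refine ⟨h, lt_of_le_of_ne (Int.fract_nonneg α) ?_, Int.fract_lt_one α⟩
    exact fun h0 => h.ne_zero h0.symm
  | succ n ih =>
    obtain ⟨h, -, -⟩ := ih
    have h' : Irrational (1 / rem α n) := by
      rw [one_div]; exact h.inv
    have hi : Irrational (rem α (n + 1)) := by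
      have := h'.intCast_sub ⌈1 / rem α n⌉
      simpa only [rem] using this
    refine ⟨hi, ?_, ?_⟩
    · have h1 : 0 ≤ rem α (n + 1) := by
        simp only [rem]; linarith [Int.le_ceil (1 / rem α n)]
      exact lt_of_le_of_ne h1 (fun h0 => hi.ne_zero h0.symm)
    · simp only [rem]; linarith [Int.ceil_lt_add_one (1 / rem α n)]

lemma rem_pos {α : ℝ} (hα : Irrational α) (n : ℕ) : 0 < rem α n := (rem_spec hα n).2.1

lemma rem_lt_one {α : ℝ} (hα : Irrational α) (n : ℕ) : rem α n < 1 := (rem_spec hα n).2.2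

lemma rem_succ {α : ℝ} (hα : Irrational α) (n : ℕ) :
    rem α (n + 1) = pq α n - 1 / rem α n := by
  have h : 0 ≤ 1 / rem α n := (one_div_pos.2 (rem_pos hα n)).le
  simp only [rem, pq]
  rw [natCast_ceil_eq_intCast_ceil h]

lemma rem_mul {α : ℝ} (hα : Irrational α) (n : ℕ) :
    rem α n * (pq α n - rem α (n + 1)) = 1 := by
  have h := (rem_pos hα n).ne'
  rw [rem_succ hα]
  field_simp
  ring

lemma two_le_pq {α : ℝ} (hα : Irrational α) (n : ℕ) : 2 ≤ pq α n := by
  have h1 : (1 : ℝ) < pq α n := by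
    have := rem_mul hα n
    have := rem_pos hα n
    have := rem_lt_one hα n
    have := rem_pos hα (n + 1)
    nlinarith
  exact_mod_cast h1

/-- `D_{n-1} = α₀ ⋯ α_{n-1}`. -/
noncomputable def remProd (α : ℝ) : ℕ → ℝ
  | 0 => 1
  | n + 1 => remProd α n * rem α n

/-- `q_{n-1}`. -/
noncomputable def den (α : ℝ) : ℕ → ℝ
  | 0 => 0
  | 1 => 1
  | n + 2 => pq α n * den α (n + 1) - den α n

lemma remProd_pos {α : ℝ} (hα : Irrational α) (n : ℕ) : 0 < remProd α n := by
  induction n with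
  | zero => exact one_pos
  | succ n ih => exact mul_pos ih (rem_pos hα n)

lemma remProd_succ (α : ℝ) (n : ℕ) : remProd α (n + 1) = remProd α n * rem α n := rfl

lemma remProd_rec {α : ℝ} (hα : Irrational α) (n : ℕ) :
    remProd α (n + 2) = pq α n * remProd α (n + 1) - remProd α n := by
  have := rem_mul hα n
  simp only [remProd_succ]
  linear_combination (-remProd α n) * this

lemma remProd_succ_lt {α : ℝ} (hα : Irrational α) (n : ℕ) : remProd α (n + 1) < remProd α n := by
  rw [remProd_succ]
  nlinarith [remProd_pos hα n, rem_lt_one hα n]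

lemma D_eq_remProd {α : ℝ} (hα : Irrational α) (n : ℕ) : D α n = remProd α (n + 1) := by
  induction n using Nat.twoStepInduction with
  | zero => simp [D, convDen, convNum, remProd, rem]
  | one =>
    have := remProd_rec hα 0
    rw [this]
    simp [D, convDen, convNum, remProd, rem]
  | more n h0 h1 =>
    rw [remProd_rec hα (n + 1), ← h0, ← h1]
    simp only [D, convDen, convNum]
    push_cast
    ring

lemma den_rec (α : ℝ) (n : ℕ) : den α (n + 2) = pq α n * den α (n + 1) - den α n := rfl

lemma den_mono {α : ℝ} (hα : Irrational α) (n : ℕ) : 0 ≤ den α n ∧ den α n + 1 ≤ den α (n + 1) := by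
  induction n with
  | zero => simp [den]
  | succ n ih =>
    have : (2 : ℝ) ≤ pq α n := by exact_mod_cast two_le_pq hα n
    refine ⟨by linarith, ?_⟩
    rw [den_rec]
    nlinarith

lemma den_nonneg {α : ℝ} (hα : Irrational α) (n : ℕ) : 0 ≤ den α n := (den_mono hα n).1

lemma den_lt_succ {α : ℝ} (hα : Irrational α) (n : ℕ) : den α n < den α (n + 1) := by
  linarith [(den_mono hα n).2]

lemma den_succ_pos {α : ℝ} (hα : Irrational α) (n : ℕ) : 0 < den α (n + 1) :=
  (den_nonneg hα n).trans_lt (den_lt_succ hα n)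

lemma remProd_den_det {α : ℝ} (hα : Irrational α) (n : ℕ) :
    remProd α n * den α (n + 1) - remProd α (n + 1) * den α n = 1 := by
  induction n with
  | zero => simp [remProd, den]
  | succ n ih =>
    rw [remProd_rec hα, den_rec]
    linarith

/-! ### The signs `t_i` and the partial sums they produce -/

/-- The sign carried by the next odd partial quotient. -/
noncomputable def oddSign (α : ℝ) (n : ℕ) : ℤ := (-1) ^ ((Finset.range n).filter (fun k => Odd (pq α k))).card

lemma oddSign_zero (α : ℝ) : oddSign α 0 = 1 := by simp [oddSign]

lemma oddSign_succ (α : ℝ) (n : ℕ) :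
    oddSign α (n + 1) = if Even (pq α n) then oddSign α n else -oddSign α n := by
  unfold oddSign
  rw [Finset.range_add_one, Finset.filter_insert]
  split_ifs with h1 h2 h2
  · exact absurd h2 (Nat.not_even_iff_odd.2 h1)
  · rw [Finset.card_insert_of_notMem (by simp), pow_succ]; ring
  · rfl
  · exact absurd (Nat.not_odd_iff_even.1 h1) h2

lemma tSeq_eq (α : ℝ) (n : ℕ) : tSeq α n = if Even (pq α n) then 0 else oddSign α n := by
  unfold tSeq
  split_ifs with h
  · rfl
  · have := oddSign_succ α n
    rw [if_neg h] at this
    rw [pow_succ, ← oddSign, this]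
    ring

lemma oddSign_eq (α : ℝ) (n : ℕ) : oddSign α n = 1 ∨ oddSign α n = -1 :=
  neg_one_pow_eq_or ℤ _

lemma oddSign_sq (α : ℝ) (n : ℕ) : (oddSign α n : ℝ) * oddSign α n = 1 := by
  rcases oddSign_eq α n with h | h <;> simp [h]

lemma abs_tSeq_le (α : ℝ) (n : ℕ) : |(tSeq α n : ℝ)| ≤ 1 := by
  rw [tSeq_eq]
  split_ifs
  · simp
  · rcases oddSign_eq α n with h | h <;> simp [h]

/-- The absolute value of `∑_{i < n} t_{i+1} q_i`. -/
noncomputable def headSum (α : ℝ) : ℕ → ℝ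
  | 0 => 0
  | n + 1 => if Even (pq α n) then headSum α n else den α (n + 1) - headSum α n

/-- The absolute value of `∑_{i ≥ n} t_{i+1} D_i`. -/
noncomputable def tailSum (α : ℝ) (n : ℕ) : ℝ :=
  oddSign α n * ∑' j, (tSeq α (j + n) : ℝ) * remProd α (j + n + 1)

lemma headSum_mem {α : ℝ} (hα : Irrational α) (n : ℕ) :
    0 ≤ headSum α n ∧ headSum α n ≤ den α n := by
  induction n with
  | zero => simp [headSum, den]
  | succ n ih =>
    have := den_lt_succ hα n
    simp only [headSum]
    split_ifs <;> constructor <;> linarith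

lemma eventually_le_pq {α : ℝ} {r : ℕ} (hr : 1 ≤ r) (h : (r : ℕ∞) ≤ R α) :
    ∀ᶠ n in Filter.atTop, r ≤ pq α n := by
  have h1 : ((r - 1 : ℕ) : ℕ∞) < R α := by
    refine lt_of_lt_of_le ?_ h
    exact_mod_cast (by omega : r - 1 < r)
  filter_upwards [Filter.eventually_lt_of_lt_liminf h1] with n hn
  have : r - 1 < pq α n := by exact_mod_cast hn
  omega

lemma summable_remProd {α : ℝ} (hα : Irrational α) (h : ∀ᶠ n in Filter.atTop, 3 ≤ pq α n) :
    Summable (remProd α) := by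
  refine summable_of_ratio_norm_eventually_le (r := 1 / 2) (by norm_num) ?_
  filter_upwards [h] with n hn
  have h3 : (3 : ℝ) ≤ pq α n := by exact_mod_cast hn
  rw [Real.norm_of_nonneg (remProd_pos hα _).le, Real.norm_of_nonneg (remProd_pos hα _).le,
    remProd_succ]
  have : rem α n ≤ 1 / 2 := by
    nlinarith [rem_mul hα n, rem_lt_one hα (n + 1), rem_pos hα n]
  nlinarith [remProd_pos hα n]

lemma summable_tSeq_mul {α : ℝ} (hα : Irrational α) (h : Summable (remProd α)) :
    Summable (fun j => (tSeq α j : ℝ) * remProd α (j + 1)) := by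
  refine Summable.of_norm_bounded ((summable_nat_add_iff 1).2 h) (fun j => ?_)
  rw [norm_mul, Real.norm_of_nonneg (remProd_pos hα _).le]
  exact mul_le_of_le_one_left (remProd_pos hα _).le (abs_tSeq_le α j)

lemma tailSum_eq {α : ℝ} (hα : Irrational α) (h : Summable (remProd α)) (n : ℕ) :
    tailSum α n = if Even (pq α n) then tailSum α (n + 1)
      else remProd α (n + 1) - tailSum α (n + 1) := by
  have hs := (summable_nat_add_iff n).2 (summable_tSeq_mul hα h)
  have e : ∀ j, j + 1 + n = j + (n + 1) := fun j => by ring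
  have hsq := oddSign_sq α n
  unfold tailSum
  rw [hs.tsum_eq_zero_add, oddSign_succ]
  simp only [e, zero_add]
  have ht := tSeq_eq α n
  split_ifs at ht ⊢ with hE
  · rw [ht]; simp
  · rw [ht]
    push_cast
    linear_combination remProd α (n + 1) * hsq

lemma tendsto_tailSum {α : ℝ} : Filter.Tendsto (tailSum α) Filter.atTop (nhds 0) := by
  -- A non-summable family has `tsum` zero, so the tails tend to 0 in every case.
  have h0 := tendsto_sum_nat_add (fun j => (tSeq α j : ℝ) * remProd α (j + 1))
  rw [tendsto_zero_iff_abs_tendsto_zero] at h0 ⊢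
  refine h0.congr (fun n => ?_)
  simp only [Function.comp, tailSum, abs_mul]
  rcases oddSign_eq α n with h | h <;> simp [h]

/-- The backward recursion T ↦ T or D - T preserves the range from 0 to D because D decreases.
Started at index n + j, it carries along an error |T_{n+j}|, which disappears as j → ∞. -/
lemma tailSum_approx {α : ℝ} (hα : Irrational α) (h : Summable (remProd α)) (j n : ℕ) :
    -|tailSum α (n + j)| ≤ tailSum α n ∧
      tailSum α n ≤ remProd α (n + 1) + |tailSum α (n + j)| := by
  induction j generalizing n with
  | zero =>
    have := remProd_pos hα (n + 1)
    exact ⟨neg_abs_le _, (le_abs_self _).trans (by simpa using this.le)⟩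
  | succ j ih =>
    have ih' := ih (n + 1)
    rw [show n + 1 + j = n + (j + 1) by ring] at ih'
    have := remProd_succ_lt hα (n + 1)
    rw [tailSum_eq hα h n]
    split_ifs <;> constructor <;> linarith [ih'.1, ih'.2]

lemma tailSum_mem {α : ℝ} (hα : Irrational α) (h : Summable (remProd α)) (n : ℕ) :
    0 ≤ tailSum α n ∧ tailSum α n ≤ remProd α (n + 1) := by
  have ht : Filter.Tendsto (fun j => |tailSum α (n + j)|) Filter.atTop (nhds 0) := by
    have := (tendsto_tailSum (α := α)).abs.comp (Filter.tendsto_add_atTop_nat n)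
    rw [abs_zero] at this
    exact this.congr (fun j => by rw [Function.comp, add_comm])
  constructor
  · have := ht.neg
    rw [neg_zero] at this
    exact le_of_tendsto' this (fun j => (tailSum_approx hα h j n).1)
  · have := ht.const_add (remProd α (n + 1))
    rw [add_zero] at this
    exact ge_of_tendsto' this (fun j => (tailSum_approx hα h j n).2)

/-! ### The number `γ*` -/

lemma gammaTerm_eq {α : ℝ} (hα : Irrational α) (n : ℕ) :
    gammaTerm α n = (1 / 2) * (remProd α (n + 2) - 2 * remProd α (n + 1) + remProd α n
      + tSeq α n * remProd α (n + 1)) := by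
  rw [gammaTerm, D_eq_remProd hα, remProd_rec hα]
  ring

/-- Each term is half a second difference of `remProd` plus half of t D; the second differences
telescope to 1 - α₀. -/
lemma hasSum_gammaTerm {α : ℝ} (hα : Irrational α) (h : Summable (remProd α)) :
    HasSum (gammaTerm α) ((1 / 2) * (1 - Int.fract α + tailSum α 0)) := by
  have h0 := h.hasSum
  have h1 := (hasSum_nat_add_iff' 1).2 h0
  have h2 := (hasSum_nat_add_iff' 2).2 h0
  have ht := (summable_tSeq_mul hα h).hasSum
  have := ((((h2.sub (h1.mul_left 2)).add h0).add ht)).mul_left (1 / 2)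
  rw [funext (gammaTerm_eq hα)]
  have hv : 1 - Int.fract α + tailSum α 0 = (∑' b, remProd α b) - ∑ i ∈ Finset.range 2, remProd α i
      - 2 * ((∑' b, remProd α b) - ∑ i ∈ Finset.range 1, remProd α i) + ∑' b, remProd α b
      + ∑' b, (tSeq α b : ℝ) * remProd α (b + 1) := by
    simp only [Finset.sum_range_succ, Finset.sum_range_zero, remProd, rem, tailSum, oddSign_zero,
      add_zero, Int.cast_one]
    ring
  rw [hv]
  exact this

lemma two_mul_gammaStar {α : ℝ} (hα : Irrational α) (h : Summable (remProd α)) :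
    2 * gammaStar α = 1 - Int.fract α + tailSum α 0 := by
  rw [gammaStar, (hasSum_gammaTerm hα h).tsum_eq]
  ring

lemma gammaStar_mem {α : ℝ} (hα : Irrational α) (h : Summable (remProd α)) :
    gammaStar α ∈ Set.Ioo (0 : ℝ) 1 := by
  have h1 := two_mul_gammaStar hα h
  have h2 := tailSum_mem hα h 0
  have h3 : remProd α 1 = Int.fract α := by simp [remProd, rem]
  rw [zero_add, h3] at h2
  have := Int.fract_lt_one α
  constructor <;> linarith

/-! ### Normalised data of a frame -/

/-- `q_{n-1} / q_n`. -/
noncomputable def denRatio (α : ℝ) (n : ℕ) : ℝ := den α n / den α (n + 1)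

/-- `headSum` in units of `q_n`. -/
noncomputable def headRatio (α : ℝ) (n : ℕ) : ℝ := headSum α n / den α (n + 1)

/-- `tailSum` in units of `D_{n-1}`. -/
noncomputable def tailRatio (α : ℝ) (n : ℕ) : ℝ := tailSum α n / remProd α n

section Ratios

variable {α : ℝ} (hα : Irrational α)
include hα

lemma denRatio_nonneg (n : ℕ) : 0 ≤ denRatio α n :=
  div_nonneg (den_nonneg hα _) (den_nonneg hα _)

lemma denRatio_lt_one (n : ℕ) : denRatio α n < 1 :=
  (div_lt_one (den_succ_pos hα n)).2 (den_lt_succ hα n)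

lemma denRatio_mul (n : ℕ) : denRatio α (n + 1) * (pq α n - denRatio α n) = 1 := by
  have h1 := (den_succ_pos hα n).ne'
  have h2 := (den_succ_pos hα (n + 1)).ne'
  unfold denRatio
  field_simp
  rw [den_rec]
  ring

lemma headRatio_nonneg (n : ℕ) : 0 ≤ headRatio α n :=
  div_nonneg (headSum_mem hα n).1 (den_nonneg hα _)

lemma headRatio_le (n : ℕ) : headRatio α n ≤ denRatio α n :=
  div_le_div_of_nonneg_right (headSum_mem hα n).2 (den_nonneg hα _)

lemma headRatio_succ (n : ℕ) : headRatio α (n + 1) =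
    if Even (pq α n) then denRatio α (n + 1) * headRatio α n
      else denRatio α (n + 1) * (1 - headRatio α n) := by
  have h1 := (den_succ_pos hα n).ne'
  have h2 := (den_succ_pos hα (n + 1)).ne'
  unfold headRatio denRatio
  simp only [headSum]
  split_ifs <;> field_simp

lemma tailRatio_nonneg (h : Summable (remProd α)) (n : ℕ) : 0 ≤ tailRatio α n :=
  div_nonneg (tailSum_mem hα h n).1 (remProd_pos hα n).le

lemma tailRatio_le (h : Summable (remProd α)) (n : ℕ) : tailRatio α n ≤ rem α n := by
  have h1 := (tailSum_mem hα h n).2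
  rw [remProd_succ, mul_comm] at h1
  exact (div_le_iff₀ (remProd_pos hα n)).2 h1

lemma tailRatio_eq (h : Summable (remProd α)) (n : ℕ) : tailRatio α n =
    if Even (pq α n) then rem α n * tailRatio α (n + 1)
      else rem α n * (1 - tailRatio α (n + 1)) := by
  have h1 := (remProd_pos hα n).ne'
  have h2 := (rem_pos hα n).ne'
  unfold tailRatio
  rw [tailSum_eq hα h n, remProd_succ]
  split_ifs <;> field_simp

lemma rem_mul_le {r n : ℕ} (h : r ≤ pq α n) : rem α n * (r - 1) ≤ 1 := by
  have : (r : ℝ) ≤ pq α n := by exact_mod_cast h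
  nlinarith [rem_mul hα n, rem_lt_one hα (n + 1), rem_pos hα n]

lemma denRatio_mul_le {r n : ℕ} (h : r ≤ pq α n) : denRatio α (n + 1) * (r - 1) ≤ 1 := by
  have : (r : ℝ) ≤ pq α n := by exact_mod_cast h
  nlinarith [denRatio_mul hα n, denRatio_lt_one hα n, denRatio_nonneg hα (n + 1)]

/-- Start from the trivial excess 1 and apply `gap_step` j times, coming back from later indices. -/
lemma rem_sub_tailRatio_le {r K : ℕ} (hr : 3 ≤ r) (hK : ∀ n ≥ K, r ≤ pq α n)
    (h : Summable (remProd α)) (j : ℕ) :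
    ∀ n ≥ K, rem α n - tailRatio α n ≤ beta r + (1 / 2) ^ j := by
  have hr3 : (3 : ℝ) ≤ r := by exact_mod_cast hr
  induction j with
  | zero =>
    intro n _
    have := rem_lt_one hα n
    have := tailRatio_nonneg hα h n
    have := beta_pos hr
    rw [pow_zero]
    linarith
  | succ j ih =>
    intro n hn
    have hn' : n + 1 ≥ K := by omega
    have := gap_step hr (hK n hn) (tailRatio_nonneg hα h (n + 1)) (tailRatio_le hα h (n + 1))
      (by nlinarith [rem_mul_le hα (hK (n + 1) hn'), rem_pos hα (n + 1)]) (by positivity)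
      (ih (n + 1) hn') (rem_mul hα n) (tailRatio_eq hα h n)
    rw [pow_succ]
    linarith

/-- Here the recursion runs forward from the past, so every halving costs one more index beyond K.
-/
lemma denRatio_sub_headRatio_le {r K : ℕ} (hr : 3 ≤ r) (hK : ∀ n ≥ K, r ≤ pq α n) (j : ℕ) :
    ∀ n ≥ K + 1 + j, denRatio α n - headRatio α n ≤ beta r + (1 / 2) ^ j := by
  have hr3 : (3 : ℝ) ≤ r := by exact_mod_cast hr
  induction j with
  | zero =>
    intro n _
    have := denRatio_lt_one hα n
    have := headRatio_nonneg hα n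
    have := beta_pos hr
    rw [pow_zero]
    linarith
  | succ j ih =>
    intro n hn
    obtain ⟨k, rfl⟩ : ∃ k, n = k + 2 := ⟨n - 2, by omega⟩
    have := gap_step hr (hK (k + 1) (by omega)) (headRatio_nonneg hα (k + 1))
      (headRatio_le hα (k + 1))
      (by nlinarith [denRatio_mul_le hα (hK k (by omega)), denRatio_nonneg hα (k + 1)])
      (by positivity) (ih (k + 1) (by omega)) (denRatio_mul hα (k + 1)) (headRatio_succ hα (k + 1))
    rw [pow_succ]
    linarith

end Ratios

/-! ### The coordinates of a grid point in a frame -/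

/-- The coordinate along `n` of the point with coefficients `A`, `-B` in the `k`-th frame; the
sign `g` allows for the reflected grid. -/
noncomputable def height (α : ℝ) (g : ℤ) (k : ℕ) (A B : ℤ) : ℝ :=
  A * den α (k + 1) - B * den α k - g * oddSign α k * headSum α k

/-- Minus the coordinate along `n α - γ` of the point with coefficients `A`, `-B` in the `k`-th
frame. -/
noncomputable def width (α : ℝ) (g : ℤ) (k : ℕ) (A B : ℤ) : ℝ :=
  B * remProd α k - A * remProd α (k + 1) + g * oddSign α k * tailSum α k

lemma height_neg (α : ℝ) (g : ℤ) (k : ℕ) (A B : ℤ) :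
    height α (-g) k (-A) (-B) = -height α g k A B := by
  unfold height; push_cast; ring

lemma width_neg (α : ℝ) (g : ℤ) (k : ℕ) (A B : ℤ) :
    width α (-g) k (-A) (-B) = -width α g k A B := by
  unfold width; push_cast; ring

lemma height_succ (α : ℝ) (g : ℤ) (k : ℕ) (A B : ℤ) :
    height α g (k + 1) B (pq α k * B - A + g * tSeq α k) = height α g k A B := by
  unfold height
  rw [den_rec, oddSign_succ, tSeq_eq]
  simp only [headSum]
  split_ifs <;> push_cast <;> ring

lemma width_succ {α : ℝ} (hα : Irrational α) (h : Summable (remProd α)) (g : ℤ) (k : ℕ)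
    (A B : ℤ) :
    width α g (k + 1) B (pq α k * B - A + g * tSeq α k) = width α g k A B := by
  unfold width
  rw [remProd_rec hα, oddSign_succ, tSeq_eq, tailSum_eq hα h k]
  split_ifs <;> push_cast <;> ring

/-- This is what the t_i are for: a and t have the same parity. -/
lemma odd_next {α : ℝ} {g A B : ℤ} {k : ℕ} (hg : g = 1 ∨ g = -1) (hA : Odd A) (hB : Odd B) :
    Odd (pq α k * B - A + g * tSeq α k) := by
  have hg' : Odd g := by rcases hg with rfl | rfl <;> decide
  have ho : Odd (oddSign α k) := by rcases oddSign_eq α k with h | h <;> rw [h] <;> decide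
  rw [tSeq_eq]
  by_cases h : Even (pq α k)
  · rw [if_pos h]
    have h' : Even (pq α k : ℤ) := by exact_mod_cast h
    have := (h'.mul_right B).sub_odd hA
    simpa using this
  · rw [if_neg h]
    have h' : Odd (pq α k : ℤ) := by exact_mod_cast Nat.not_even_iff_odd.1 h
    exact ((h'.mul hB).sub_odd hA).add_odd (hg'.mul ho)

section Frames

variable {α : ℝ} (hα : Irrational α) (h : Summable (remProd α))
include hα

lemma height_eq (g : ℤ) (k : ℕ) (A B : ℤ) : height α g k A B =
    den α (k + 1) * (A - B * denRatio α k - (g * oddSign α k : ℤ) * headRatio α k) := by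
  have h1 := (den_succ_pos hα k).ne'
  unfold height denRatio headRatio
  push_cast
  field_simp

lemma width_eq (g : ℤ) (k : ℕ) (A B : ℤ) : width α g k A B =
    remProd α k * (B - A * rem α k + (g * oddSign α k : ℤ) * tailRatio α k) := by
  have h1 := (remProd_pos hα k).ne'
  unfold width tailRatio
  rw [remProd_succ]
  push_cast
  field_simp

/-- The determinant relation in normalised form; it produces the denominator 1 - xy of the extremal
quotient. -/
lemma den_mul_remProd (k : ℕ) :
    den α (k + 1) * remProd α k * (1 - rem α k * denRatio α k) = 1 := by
  have h1 := (den_succ_pos hα k).ne'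
  have := remProd_den_det hα k
  rw [remProd_succ] at this
  unfold denRatio
  field_simp
  linarith

lemma one_le_den_mul_remProd (k : ℕ) : 1 ≤ den α (k + 1) * remProd α k := by
  have h1 := den_mul_remProd hα k
  have h2 : 0 ≤ rem α k * denRatio α k := mul_nonneg (rem_pos hα k).le (denRatio_nonneg hα k)
  have h3 : 0 < den α (k + 1) * remProd α k := mul_pos (den_succ_pos hα k) (remProd_pos hα k)
  nlinarith

omit hα in
lemma unit_mul_oddSign {g : ℤ} (hg : g = 1 ∨ g = -1) (k : ℕ) :
    g * oddSign α k = 1 ∨ g * oddSign α k = -1 := by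
  rcases hg with rfl | rfl <;> rcases oddSign_eq α k with h | h <;> simp [h]

include h

lemma one_le_of_opposite {g : ℤ} (hg : g = 1 ∨ g = -1) (k : ℕ) {A B : ℤ} (hA : 1 ≤ A)
    (hB : B ≤ -1) : 1 ≤ |height α g k A B * width α g k A B| := by
  have hA' : (1 : ℝ) ≤ A := by exact_mod_cast hA
  have hB' : (B : ℝ) ≤ -1 := by exact_mod_cast hB
  have y0 := denRatio_nonneg hα k
  have s0 := headRatio_nonneg hα k
  have s1 := headRatio_le hα k
  have x0 := rem_pos hα k
  have u0 := tailRatio_nonneg hα h k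
  have u1 := tailRatio_le hα h k
  have hd := one_le_den_mul_remProd hα k
  rw [height_eq hα, width_eq hα, mul_mul_mul_comm, abs_mul, abs_mul (_ - _ - _)]
  have hP : 1 ≤ |(A : ℝ) - B * denRatio α k - (g * oddSign α k : ℤ) * headRatio α k| := by
    refine le_trans ?_ (le_abs_self _)
    rcases unit_mul_oddSign hg k with e | e <;> rw [e] <;> push_cast <;> nlinarith
  have hW : 1 ≤ |(B : ℝ) - A * rem α k + (g * oddSign α k : ℤ) * tailRatio α k| := by
    refine le_trans ?_ (neg_le_abs _)
    rcases unit_mul_oddSign hg k with e | e <;> rw [e] <;> push_cast <;> nlinarith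
  have hd' : 1 ≤ |den α (k + 1) * remProd α k| := hd.trans (le_abs_self _)
  have := one_le_mul_of_one_le_of_one_le hP hW
  exact one_le_mul_of_one_le_of_one_le hd' this

/-- The sign g · `oddSign` decides which factor is reduced by its offset. `product_bound` is
symmetric under exchanging past and future, so it covers both signs with the roles of `denRatio` and
`rem` swapped. -/
lemma diagonal_bound {r K : ℕ} (hr : 3 ≤ r) (hK : ∀ n ≥ K, r ≤ pq α n) {j : ℕ} {g : ℤ}
    (hg : g = 1 ∨ g = -1) {k : ℕ} (hk : K + 2 + j ≤ k) {m : ℤ} (hm : 1 ≤ m) :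
    4 * C r - 4 * (1 / 2) ^ j ≤ height α g k m m * width α g k m m := by
  have hr3 : (3 : ℝ) ≤ r := by exact_mod_cast hr
  have hm' : (1 : ℝ) ≤ m := by exact_mod_cast hm
  obtain ⟨i, rfl⟩ : ∃ i, k = i + 2 := ⟨k - 2, by omega⟩
  set e : ℝ := (1 / 2) ^ j with he
  have he0 : 0 ≤ e := by positivity
  have he1 : e ≤ 1 := pow_le_one₀ (by norm_num) (by norm_num)
  have y0 := denRatio_nonneg hα (i + 2)
  have s0 := headRatio_nonneg hα (i + 2)
  have s1 := headRatio_le hα (i + 2)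
  have x0 := rem_pos hα (i + 2)
  have u0 := tailRatio_nonneg hα h (i + 2)
  have u1 := tailRatio_le hα h (i + 2)
  have y1 : denRatio α (i + 2) ≤ 1 / 2 := by
    nlinarith [denRatio_mul_le hα (hK (i + 1) (by omega))]
  have x1 : rem α (i + 2) ≤ 1 / 2 := by
    nlinarith [rem_mul_le hα (hK (i + 2) (by omega))]
  have hd := den_mul_remProd hα (i + 2)
  have hd0 : 0 < den α (i + 2 + 1) * remProd α (i + 2) :=
    mul_pos (den_succ_pos hα _) (remProd_pos hα _)
  have gx := rem_sub_tailRatio_le hα hr hK h j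
  have gy := denRatio_sub_headRatio_le hα hr hK j
  have hmain : ∀ P W : ℝ, 0 ≤ P → 0 ≤ W →
      4 * C r * (1 - rem α (i + 2) * denRatio α (i + 2)) - 3 * e ≤ P * W →
      ∀ P' W' : ℝ, P ≤ P' → W ≤ W' →
      4 * C r - 4 * e ≤ den α (i + 2 + 1) * P' * (remProd α (i + 2) * W') := by
    intro P W hP hW hPW P' W' hP' hW'
    have h1 : P * W ≤ P' * W' := mul_le_mul hP' hW' hW (hP.trans hP')
    have h2 := mul_le_mul_of_nonneg_left (hPW.trans h1) hd0.le
    -- Both ratios are at most 1/2, so the normalising factor 1/(1 - xy) is at most 4/3; the error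
    -- 3e becomes 4e.
    have h3 : den α (i + 2 + 1) * remProd α (i + 2) * 3 ≤ 4 := by
      have : rem α (i + 2) * denRatio α (i + 2) ≤ 1 / 2 * (1 / 2) := by gcongr
      nlinarith
    have h4 := mul_le_mul_of_nonneg_right h3 he0
    have h5 : den α (i + 2 + 1) * remProd α (i + 2) *
        (4 * C r * (1 - rem α (i + 2) * denRatio α (i + 2)) - 3 * e)
        = 4 * C r - den α (i + 2 + 1) * remProd α (i + 2) * 3 * e := by
      linear_combination (4 * C r) * hd
    linarith
  rw [height_eq hα, width_eq hα]
  rcases unit_mul_oddSign hg (i + 2) with e1 | e1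
  · have hp := product_bound hr (hK (i + 1) (by omega)) (headRatio_nonneg hα (i + 1))
      (headRatio_le hα (i + 1)) (denRatio_mul_le hα (hK i (by omega))) he0 he1
      (gy (i + 1) (by omega)) (denRatio_mul hα (i + 1)) (headRatio_succ hα (i + 1)) u0 u1 x1
      (gx (i + 2) (by omega))
    refine hmain (1 - denRatio α (i + 2) - headRatio α (i + 2))
      (1 - rem α (i + 2) + tailRatio α (i + 2)) (by linarith) (by linarith)
      (by rw [mul_comm (rem α _)]; linarith) _ _ ?_ ?_ <;> rw [e1] <;> push_cast <;> nlinarith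
  · have hp := product_bound hr (hK (i + 2) (by omega)) (tailRatio_nonneg hα h (i + 2 + 1))
      (tailRatio_le hα h (i + 2 + 1)) (rem_mul_le hα (hK (i + 2 + 1) (by omega))) he0 he1
      (gx (i + 2 + 1) (by omega)) (rem_mul hα (i + 2)) (tailRatio_eq hα h (i + 2)) s0 s1 y1
      (gy (i + 2) (by omega))
    refine hmain (1 - denRatio α (i + 2) + headRatio α (i + 2))
      (1 - rem α (i + 2) - tailRatio α (i + 2)) (by linarith) (by linarith)
      hp _ _ ?_ ?_ <;> rw [e1] <;> push_cast <;> nlinarith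

omit hα h in
/-- Along a segment on which one factor increases and the other decreases, both affinely, the
product is at least its minimum over the endpoints. -/
lemma le_mul_of_endpoints {n x p q d s L : ℝ} (hp : 0 ≤ p) (hs : 0 ≤ s) (hq : 0 ≤ q) (hd : 0 ≤ d)
    (h0 : L ≤ n * (x + d * (p + s))) (h1 : L ≤ (n + q * (p + s)) * x) :
    L ≤ (n + q * p) * (x + d * s) := by
  rcases eq_or_lt_of_le (add_nonneg hp hs) with hz | hz
  · have : p = 0 := by linarith
    have : s = 0 := by linarith
    subst p s
    simpa using h0
  · have h2 := mul_le_mul_of_nonneg_left h0 hs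
    have h3 := mul_le_mul_of_nonneg_left h1 hp
    have h4 : 0 ≤ (p + s) * (q * d * (p * s)) := by positivity
    refine le_of_mul_le_mul_left ?_ hz
    nlinarith

/-! ### Descent through the frames -/

lemma descent {K : ℕ} {L : ℝ} (hL : L ≤ 1) {g : ℤ} (hg : g = 1 ∨ g = -1)
    (hdiag : ∀ k ≥ K, ∀ m : ℤ, 1 ≤ m → L ≤ height α g k m m * width α g k m m) (b : ℕ) :
    ∀ k ≥ K, ∀ A B : ℤ, Odd A → Odd B → B ≤ b → 1 ≤ B → B < A →
      L ≤ |height α g k A B * width α g k A B| := by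
  induction b with
  | zero => intro k _ A B _ _ h1 h2; omega
  | succ b ih =>
    intro k hk A B hA hB hBb hB1 hBA
    have hodd := odd_next (α := α) (k := k) hg hA hB
    have eh := height_succ α g k A B
    have ew := width_succ hα h g k A B
    set E := (pq α k : ℤ) * B - A + g * tSeq α k with hE
    rcases lt_or_ge E B with hlt | hge
    · rcases lt_or_ge 0 E with hpos | hneg
      · rw [← eh, ← ew]
        exact ih (k + 1) (by omega) B E hB hodd (by push_cast at hBb; omega) (by omega) hlt
      · have : E ≠ 0 := by rintro h0; rw [h0] at hodd; exact absurd hodd (by decide)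
        rw [← eh, ← ew]
        exact hL.trans (one_le_of_opposite hα h hg (k + 1) hB1 (by omega))
    · refine le_trans ?_ (le_abs_self _)
      have p0 := hdiag k hk B hB1
      have p1 := hdiag (k + 1) (by omega) B hB1
      -- With B fixed, A lies between B and A + (E - B). These two values give the diagonal points
      -- (B, B) of frame k and of frame k + 1.
      have eh' := height_succ α g k (A + (E - B)) B
      have ew' := width_succ hα h g k (A + (E - B)) B
      have e2 : (pq α k : ℤ) * B - (A + (E - B)) + g * tSeq α k = B := by rw [hE]; ring
      rw [e2] at eh' ew'
      rw [eh', ew'] at p1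
      have key := le_mul_of_endpoints (n := height α g k B B) (x := width α g k (A + (E - B)) B)
        (p := (A : ℝ) - B) (q := den α (k + 1)) (d := remProd α (k + 1)) (s := (E : ℝ) - B) (L := L)
        (by have : (B : ℝ) ≤ A := by exact_mod_cast hBA.le
            linarith)
        (by have : (B : ℝ) ≤ E := by exact_mod_cast hge
            linarith)
        (den_nonneg hα _) (remProd_pos hα _).le
        (p0.trans_eq (by unfold width; push_cast; ring))
        (p1.trans_eq (by unfold height; push_cast; ring))
      exact key.trans_eq (by unfold height width; push_cast; ring)

lemma exists_frame (n m : ℤ) (k : ℕ) : ∃ A B : ℤ, Odd A ∧ Odd B ∧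
    height α 1 k A B = 2 * n + 1 ∧
    width α 1 k A B = -(2 * (n * Int.fract α - m - gammaStar α)) := by
  induction k with
  | zero =>
    -- Doubling γ* and the grid makes both initial coordinates odd.
    refine ⟨2 * n + 1, 2 * m + 1, odd_two_mul_add_one n, odd_two_mul_add_one m, ?_, ?_⟩
    · simp [height, den, headSum]
    · have := two_mul_gammaStar hα h
      simp [width, remProd, rem, oddSign_zero]
      linarith
  | succ k ih =>
    obtain ⟨A, B, hA, hB, h1, h2⟩ := ih
    refine ⟨B, pq α k * B - A + 1 * tSeq α k, hB, odd_next (Or.inl rfl) hA hB, ?_, ?_⟩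
    · rw [height_succ, h1]
    · rw [width_succ hα h, h2]

lemma width_lower {g : ℤ} (hg : g = 1 ∨ g = -1) (k : ℕ) {A B : ℤ} (hA : 1 ≤ A) (hAB : A ≤ B)
    (hx : rem α k ≤ 1 / 2) : remProd α k * (1 - 2 * rem α k) ≤ |width α g k A B| := by
  have hA' : (1 : ℝ) ≤ A := by exact_mod_cast hA
  have hB' : (A : ℝ) ≤ B := by exact_mod_cast hAB
  have x0 := rem_pos hα k
  have u0 := tailRatio_nonneg hα h k
  have u1 := tailRatio_le hα h k
  refine le_trans ?_ (le_abs_self _)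
  rw [width_eq hα]
  refine mul_le_mul_of_nonneg_left ?_ (remProd_pos hα k).le
  rcases unit_mul_oddSign hg k with e | e <;> rw [e] <;> push_cast <;> nlinarith

/-- Grid points close to the axis have product at least `L`. -/
theorem product_or_width_bound {r : ℕ} (hr : 3 ≤ r) (hpq : ∀ᶠ n in Filter.atTop, r ≤ pq α n)
    {L : ℝ} (hL : L < 4 * C r) : ∃ c > 0, ∀ n m : ℤ,
      L ≤ |(2 * n + 1) * (2 * (n * Int.fract α - m - gammaStar α))| ∨
      c ≤ |2 * (n * Int.fract α - m - gammaStar α)| := by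
  obtain ⟨K, hK⟩ := Filter.eventually_atTop.1 hpq
  have hr3 : (3 : ℝ) ≤ r := by exact_mod_cast hr
  obtain ⟨j, hj⟩ := exists_pow_lt_of_lt_one (show 0 < (4 * C r - L) / 4 by linarith)
    (show (1 / 2 : ℝ) < 1 by norm_num)
  have hL1 : L ≤ 1 := hL.le.trans (four_mul_C_le_one hr)
  set k := K + 2 + j with hk
  have hx : rem α k < 1 / 2 := by
    have : (r : ℝ) ≤ pq α k := by exact_mod_cast hK k (by omega)
    nlinarith [rem_mul hα k, rem_lt_one hα (k + 1), rem_pos hα k]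
  have hdiag : ∀ g : ℤ, (g = 1 ∨ g = -1) → ∀ i ≥ k, ∀ m : ℤ, 1 ≤ m →
      L ≤ height α g i m m * width α g i m m := by
    intro g hg i hi m hm
    have := diagonal_bound hα h hr hK hg (j := j) (k := i) hi hm
    linarith
  refine ⟨remProd α k * (1 - 2 * rem α k), mul_pos (remProd_pos hα k) (by linarith), ?_⟩
  have main : ∀ g : ℤ, (g = 1 ∨ g = -1) → ∀ A B : ℤ, Odd A → Odd B → 1 ≤ A →
      L ≤ |height α g k A B * width α g k A B| ∨
      remProd α k * (1 - 2 * rem α k) ≤ |width α g k A B| := by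
    intro g hg A B hA hB hA1
    have hB0 : B ≠ 0 := by rintro rfl; exact absurd hB (by decide)
    rcases lt_or_gt_of_ne hB0 with hneg | hpos
    · exact Or.inl (hL1.trans (one_le_of_opposite hα h hg k hA1 (by omega)))
    · rcases lt_or_ge B A with hlt | hge
      · exact Or.inl (descent hα h hL1 hg (hdiag g hg) B.toNat k le_rfl A B hA hB
          (Int.self_le_toNat B) hpos hlt)
      · exact Or.inr (width_lower hα h hg k hA1 hge hx.le)
  intro n m
  obtain ⟨A, B, hA, hB, h1, h2⟩ := exists_frame hα h n m k
  have e1 : (2 * n + 1) * (2 * (n * Int.fract α - m - gammaStar α))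
      = -(height α 1 k A B * width α 1 k A B) := by rw [h1, h2]; ring
  have e2 : 2 * (n * Int.fract α - m - gammaStar α) = -width α 1 k A B := by rw [h2]; ring
  rw [e1, e2, abs_neg, abs_neg]
  have hA0 : A ≠ 0 := by rintro rfl; exact absurd hA (by decide)
  rcases lt_or_gt_of_ne hA0 with hneg | hpos
  · have := main (-1) (Or.inr rfl) (-A) (-B) hA.neg hB.neg (by omega)
    rwa [height_neg, width_neg, neg_mul_neg, abs_neg] at this
  · exact main 1 (Or.inl rfl) A B hA hB hpos

end Frames

/-! ### Lower bounds for M(α, γ*) -/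

lemma gammaStar_notMem_homogeneous {α : ℝ} (hα : Irrational α)
    (hpq : ∀ᶠ n in Filter.atTop, 3 ≤ pq α n) : gammaStar α ∉ homogeneous α := by
  rintro ⟨m, l, hml⟩
  have hC := C_pos (le_refl 3)
  -- A representation of γ* in ℤ + αℤ would give a grid point of width 0, contradicting both
  -- alternatives.
  obtain ⟨c, hc, hbd⟩ := product_or_width_bound hα (summable_remProd hα hpq) le_rfl hpq
    (show 2 * C 3 < 4 * C 3 by linarith)
  have h0 : (l : ℝ) * Int.fract α - (-m - l * ⌊α⌋ : ℤ) - gammaStar α = 0 := by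
    rw [hml, Int.fract]; push_cast; ring
  have := hbd l (-m - l * ⌊α⌋)
  rw [h0, mul_zero, mul_zero, abs_zero] at this
  rcases this with h | h <;> linarith

lemma C_le_M_gammaStar {α : ℝ} (hα : Irrational α) {r : ℕ} (hr : 3 ≤ r)
    (hpq : ∀ᶠ n in Filter.atTop, r ≤ pq α n) : (C r : EReal) ≤ M α (gammaStar α) := by
  have hs := summable_remProd hα (hpq.mono fun n hn => hr.trans hn)
  by_contra! hlt
  obtain ⟨c, hc1, hc2⟩ := EReal.lt_iff_exists_real_btwn.1 hlt
  have hc : c < C r := by exact_mod_cast hc2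
  refine absurd hc1 (not_lt.2 ?_)
  obtain ⟨d, hd, hbd⟩ := product_or_width_bound hα hs hr hpq
    (show 2 * c + 2 * C r < 4 * C r by linarith)
  -- With w the distance: if 2w ≥ η, then |n|w ≥ 1/2 > c for large |n|. Otherwise replacing |2n+1|
  -- by 2|n| costs at most 2w < η, which the margin 2C - 2c absorbs.
  set η := min d (2 * C r - 2 * c) with hη
  have hη0 : 0 < η := lt_min hd (by linarith)
  have htend : Filter.Tendsto (fun n : ℤ => |(n : ℝ)|) Filter.cofinite Filter.atTop :=
    tendsto_norm_cocompact_atTop.comp Int.tendsto_coe_cofinite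
  refine Filter.le_liminf_of_le (by isBoundedDefault) ?_
  filter_upwards [htend.eventually_ge_atTop (1 / η)] with n hn
  rw [EReal.coe_le_coe_iff]
  set k := round (n * α - gammaStar α) with hk
  have hξ : nearestDist (n * α - gammaStar α)
      = |n * Int.fract α - (k - n * ⌊α⌋ : ℤ) - gammaStar α| := by
    rw [nearestDist, Int.fract, ← hk]; push_cast; congr 1; ring
  have hb := hbd n (k - n * ⌊α⌋)
  rw [abs_mul, abs_mul 2, ← hξ, abs_two] at hb
  set w := nearestDist (n * α - gammaStar α) with hw
  have hw0 : 0 ≤ w := abs_nonneg _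
  have hC1 := four_mul_C_le_one hr
  rcases le_or_gt η (2 * w) with hle | hgt
  · have h1 : 1 ≤ |(n : ℝ)| * η := by
      rwa [div_le_iff₀ hη0] at hn
    have h2 : |(n : ℝ)| * η ≤ |(n : ℝ)| * (2 * w) := by gcongr
    linarith
  · have hηd : η ≤ d := min_le_left _ _
    have hηc : η ≤ 2 * C r - 2 * c := min_le_right _ _
    rcases hb with hb | hb
    · have h1 : |2 * (n : ℝ) + 1| ≤ 2 * |(n : ℝ)| + 1 := by
        refine (abs_add_le _ _).trans ?_
        rw [abs_mul, abs_two, abs_one]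
      have h2 := mul_le_mul_of_nonneg_right h1 (by positivity : 0 ≤ 2 * w)
      nlinarith
    · linarith

lemma CExt_le_M_gammaStar {α : ℝ} (hα : Irrational α) (hR : 3 ≤ R α) :
    (CExt (R α) : EReal) ≤ M α (gammaStar α) := by
  unfold CExt
  split_ifs with htop
  · by_contra! hlt
    obtain ⟨c, hc1, hc2⟩ := EReal.lt_iff_exists_real_btwn.1 hlt
    have hc : c < 1 / 4 := by exact_mod_cast hc2
    have ht : Filter.Tendsto (fun r : ℕ => (1 - 3 / ((r : ℝ) - 1)) / 4) Filter.atTop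
        (nhds (1 / 4)) := by
      have h1 : Filter.Tendsto (fun r : ℕ => (r : ℝ) - 1) Filter.atTop Filter.atTop :=
        Filter.tendsto_atTop_add_const_right _ (-1) tendsto_natCast_atTop_atTop
      have := ((h1.const_div_atTop 3).const_sub 1).div_const 4
      rwa [sub_zero] at this
    obtain ⟨r, hr1, hr2⟩ := (((tendsto_order.1 ht).1 c hc).and (Filter.eventually_ge_atTop 3)).exists
    have hpq := eventually_le_pq (α := α) (r := r) (by omega) (by rw [htop]; exact le_top)
    have h2 : (c : EReal) < C r := by exact_mod_cast hr1.trans_le (C_lower hr2)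
    exact absurd (hc1.trans (h2.trans_le (C_le_M_gammaStar hα hr2 hpq))) (lt_irrefl _)
  · have e : ((R α).toNat : ℕ∞) = R α := ENat.natCast_toNat htop
    have h3 : 3 ≤ (R α).toNat := by
      rw [← e] at hR
      exact_mod_cast hR
    exact C_le_M_gammaStar hα h3 (eventually_le_pq (by omega) e.le)

end NegCF

theorem theorem1 (α : ℝ) (hα : Irrational α) (hR : 3 ≤ NegCF.R α) :
    (Summable (NegCF.gammaTerm α) ∧ NegCF.gammaStar α ∈ Set.Ioo (0 : ℝ) 1 ∧
      NegCF.gammaStar α ∉ NegCF.homogeneous α) ∧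
    (NegCF.M α (NegCF.gammaStar α) ≤ NegCF.rho α ∧
      (NegCF.CExt (NegCF.R α) : EReal) ≤ NegCF.M α (NegCF.gammaStar α)) ∧
    (NegCF.R α = 3 → (NegCF.C 3 : EReal) ≤ NegCF.rho α) ∧
    (4 ≤ NegCF.R α → (NegCF.C 4 : EReal) ≤ NegCF.rho α) ∧
    NegCF.C 3 = 1 / (6 * √3 + 8) ∧
    NegCF.C 4 = 1 / (4 * √3 + 2) := by
  have hpq : ∀ᶠ n in Filter.atTop, 3 ≤ NegCF.pq α n :=
    NegCF.eventually_le_pq (by norm_num) (by exact_mod_cast hR)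
  have hs := NegCF.summable_remProd hα hpq
  have hnot := NegCF.gammaStar_notMem_homogeneous hα hpq
  have hrho : NegCF.M α (NegCF.gammaStar α) ≤ NegCF.rho α :=
    le_iSup₂_of_le (NegCF.gammaStar α) hnot le_rfl
  refine ⟨⟨(NegCF.hasSum_gammaTerm hα hs).summable, NegCF.gammaStar_mem hα hs, hnot⟩,
    ⟨hrho, NegCF.CExt_le_M_gammaStar hα hR⟩, fun _ => ?_, fun h4 => ?_, NegCF.C_three,
    NegCF.C_four⟩
  · exact (NegCF.C_le_M_gammaStar hα le_rfl hpq).trans hrho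
  · exact (NegCF.C_le_M_gammaStar hα (by norm_num)
      (NegCF.eventually_le_pq (by norm_num) (by exact_mod_cast h4))).trans hrho
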